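/- For a morphism of schemes $f : X \to S$, let $\mathrm{Rel}(f) \subseteq S$ be the set of points of the form $f(x)$, where $x \in X$ is a point such that the residue field extension $\kappa(f(x)) \to \kappa(x)$ is trivial (an isomorphism). A scheme $S$ is called a \emph{strict Poonen scheme} if for every nonempty open subscheme $U \subseteq S$ and every dominant morphism of finite presentation $f : X \to U$, the set $\mathrm{Rel}(f)$ is nonempty. (1) Let $k$ be a perfect field. Every $k$-scheme of finite type without isolated points is a strict Poonen scheme. (2) Every $\mathbb{Z}$-scheme of finite type without isolated points is a strict Poonen scheme. (An isolated point of a scheme is a point $s$ such that $\{s\}$ is open in the underlying topological space.) -/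

import Mathlib

open CategoryTheory AlgebraicGeometry

universe u

/-- A morphism of finite presentation: locally of finite presentation, quasi-compact and
quasi-separated. -/
class IsOfFinitePresentation {X S : Scheme.{u}} (f : X ⟶ S) : Prop where
  locallyOfFinitePresentation : LocallyOfFinitePresentation f
  quasiCompact : QuasiCompact f
  quasiSeparated : QuasiSeparated f

/-- A morphism of finite type: locally of finite type and quasi-compact. -/
class IsOfFiniteType {X S : Scheme.{u}} (f : X ⟶ S) : Prop where
  locallyOfFiniteType : LocallyOfFiniteType f
  quasiCompact : QuasiCompact f

/-- The set of points `x` of `X` whose residue field extension `κ(f x) → κ(x)` is trivial. -/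
def relTilde {X S : Scheme.{u}} (f : X ⟶ S) : Set X :=
  {x | Function.Bijective (f.residueFieldMap x).hom}

/-- The set of points of `S` that lift to `X`: the image of `relTilde f`. -/
def rel {X S : Scheme.{u}} (f : X ⟶ S) : Set S :=
  f '' relTilde f

/-- `S` is a strict Poonen scheme if for every nonempty open `U ⊆ S` and every dominant
`f : X ⟶ U` of finite presentation, some point of `U` lifts to `X`. -/
def IsStrictPoonen (S : Scheme.{u}) : Prop :=
  ∀ (U : S.Opens), (U : Set S).Nonempty →
    ∀ (X : Scheme.{u}) (f : X ⟶ (U : Scheme.{u})),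
      IsOfFinitePresentation f → IsDominant f → (rel f).Nonempty

/-- No point of the underlying topological space is isolated. -/
def HasNoIsolatedPoint (S : Scheme.{u}) : Prop :=
  ∀ s : S, ¬ IsOpen ({s} : Set S)

/-! On affine pieces `f` is a ring map `A → B` between algebras of finite type over the base, and a
dichotomy holds: either `A → B ⧸ P` is surjective for some maximal `P`, which gives a point of `rel
f`, or `Spec B → Spec A` lands in finitely many closed points. If the second case held on every
piece over an affine open `V`, quasi-compactness and density would make `V` finite and discrete, so
`S` would have isolated points.

Over a perfect field `k`, if every element of the image of `A` is algebraic, that image is a finite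
`k`-algebra. Otherwise some `b` in it is transcendental, and a closed point of `Spec B` with residue
field `k(b)` is needed (`exists_isMaximal_forall_sub_aeval_mem`). Pass to a field `K` finite over
`k(t)`, with `t` the image of `b`. Up to `q`-power roots, `K` is `k(t, u)` with `u` transcendental,
and such roots are harmless in the perfect residue fields. It remains to specialise so that `u ∈
k(t)`. For `k` infinite, let `u` take a value in `k`. For `k` finite, give `u` a large prime degree
`l`; outside finitely many values of `t` this forces `l ∣ deg t`, hence `u ∈ k(t)`.

Over `ℤ`, if `ℤ → B` is injective then `B` maps to some `ZMod p`, onto which `ℤ` already surjects.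
Otherwise a nonzero integer vanishes in `B`, and its prime factors reduce the claim to the fields
`ZMod p`. -/

/-! ### Specialisation in transcendence degree one -/

theorem exists_ne_zero_forall_isIntegral_pow_smul {R K : Type*} [CommRing R] [IsDomain R]
    [CommRing K] [Algebra R K] [Algebra.IsAlgebraic R K] (s : Finset K) :
    ∃ h : R, h ≠ 0 ∧ ∀ x ∈ Algebra.adjoin R (s : Set K), ∃ n : ℕ, IsIntegral R (h ^ n • x) := by
  classical
  choose c hc0 hc using fun x : K ↦
    (Algebra.IsAlgebraic.isAlgebraic (R := R) x).exists_integral_multiple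
  refine ⟨∏ x ∈ s, c x, Finset.prod_ne_zero_iff.mpr fun x _ ↦ hc0 x, fun x hx ↦ ?_⟩
  induction hx using Algebra.adjoin_induction with
  | mem x hx =>
    refine ⟨1, ?_⟩
    rw [pow_one, ← Finset.prod_erase_mul _ _ (Finset.mem_coe.mp hx), mul_smul]
    exact (hc x).smul _
  | algebraMap r => exact ⟨0, by simpa using isIntegral_algebraMap⟩
  | add x y _ _ hx hy =>
    obtain ⟨m, hm⟩ := hx
    obtain ⟨n, hn⟩ := hy
    refine ⟨m + n, ?_⟩
    have h1 (a : K) (c : R) : c ^ (m + n) • a = c ^ n • c ^ m • a := by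
      rw [smul_smul, ← pow_add, add_comm]
    have h2 (a : K) (c : R) : c ^ (m + n) • a = c ^ m • c ^ n • a := by
      rw [smul_smul, ← pow_add]
    rw [smul_add, h1 x, h2 y]
    exact (hm.smul _).add (hn.smul _)
  | mul x y _ _ hx hy =>
    obtain ⟨m, hm⟩ := hx
    obtain ⟨n, hn⟩ := hy
    refine ⟨m + n, ?_⟩
    rw [pow_add, ← smul_mul_smul_comm]
    exact hm.mul hn

open Polynomial IntermediateField in
/-- In a finitely generated `k`-algebra `C` of transcendence degree one, almost all irreducible
polynomials in `u` fail to be units. -/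
theorem exists_forall_irreducible_not_dvd_exists_algHom {k : Type*} {K : Type u} [Field k] [Field K]
    [Algebra k K] {u : K} (hu : Transcendental k u)
    [Algebra.IsAlgebraic (Algebra.adjoin k {u}) K] (C : Subalgebra k K) (hC : C.FG)
    (huC : u ∈ C) :
    ∃ h : k[X], h ≠ 0 ∧ ∀ π : k[X], Irreducible π → ¬ π ∣ h →
      ∃ (L : Type u) (_ : Field L) (_ : Algebra k L) (ψ : C →ₐ[k] L),
        Module.Finite k L ∧ aeval (ψ ⟨u, huC⟩) π = 0 := by
  classical
  set R := Algebra.adjoin k {u}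
  let e := algEquivOfTranscendental k u hu
  have he (p : k[X]) : ((e p : R) : K) = aeval u p := by
    simp [e]
  have : IsIntegrallyClosed R := IsIntegrallyClosed.of_equiv e.toRingEquiv
  obtain ⟨s, hs⟩ := hC
  obtain ⟨h, h0, hh⟩ := exists_ne_zero_forall_isIntegral_pow_smul (R := R) (K := K) s
  refine ⟨e.symm h, by simpa using h0, fun π hπ hdvd ↦ ?_⟩
  suffices hunit : ¬ IsUnit (aeval (⟨u, huC⟩ : C) π) by
    obtain ⟨M, hM, hM'⟩ := exists_max_ideal_of_mem_nonunits hunit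
    let : Field (C ⧸ M) := Ideal.Quotient.field M
    have : Algebra.FiniteType k C := C.fg_iff_finiteType.mp ⟨s, hs⟩
    have : Algebra.FiniteType k (C ⧸ M) :=
      .of_surjective (Ideal.Quotient.mkₐ k M) (Ideal.Quotient.mkₐ_surjective k M)
    refine ⟨C ⧸ M, inferInstance, inferInstance, Ideal.Quotient.mkₐ k M,
      finite_of_finite_type_of_isJacobsonRing k _, ?_⟩
    rw [aeval_algHom_apply]
    exact Ideal.Quotient.eq_zero_iff_mem.mpr hM'
  rintro hunit
  obtain ⟨v, hv⟩ := hunit.exists_right_inv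
  have hv' : aeval u π * (v : K) = 1 := by
    have := congrArg (C.val) hv
    rwa [map_mul, map_one, ← aeval_algHom_apply] at this
  have hvs : (v : K) ∈ Algebra.adjoin R (s : Set K) := by
    have h1 : (v : K) ∈ Algebra.adjoin k (s : Set K) := hs ▸ v.2
    have h2 : Algebra.adjoin k (s : Set K) ≤ (Algebra.adjoin R (s : Set K)).restrictScalars k :=
      Algebra.adjoin_le Algebra.subset_adjoin
    exact h2 h1
  obtain ⟨n, hn⟩ := hh _ hvs
  have hπ0 : aeval u π ≠ 0 := left_ne_zero_of_mul_eq_one hv'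
  -- `h ^ n / π(u)` is integral over `k[u]` and lies in its fraction field, so it lies in `k[u]`;
  -- thus `π ∣ h ^ n`.
  have hr : ∃ r : R, (r : K) = (h : K) ^ n * v := by
    let F := FractionRing R
    let : Algebra F K := FractionRing.liftAlgebra R K
    have : IsScalarTower R F K := FractionRing.isScalarTower_liftAlgebra R K
    have hF (a : R) : algebraMap F K (algebraMap R F a) = a :=
      (IsScalarTower.algebraMap_apply R F K a).symm
    have key : algebraMap F K (algebraMap R F h ^ n / algebraMap R F (e π)) = (h : K) ^ n * v := by
      rw [map_div₀, map_pow, hF, hF, he, div_eq_iff hπ0]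
      linear_combination (-(h : K) ^ n) * hv'
    have hint : IsIntegral R (algebraMap R F h ^ n / algebraMap R F (e π)) := by
      rw [← isIntegral_algebraMap_iff (algebraMap F K).injective, key]
      rwa [Algebra.smul_def, map_pow] at hn
    obtain ⟨r, hr⟩ := IsIntegrallyClosed.algebraMap_eq_of_integral hint
    exact ⟨r, by rw [← key, ← hr, hF]⟩
  obtain ⟨r, hr⟩ := hr
  refine hdvd (hπ.prime.dvd_of_dvd_pow (n := n) ⟨e.symm r, ?_⟩)
  apply e.injective
  rw [map_pow, map_mul, e.apply_symm_apply, e.apply_symm_apply]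
  apply Subtype.val_injective
  rw [Subalgebra.coe_mul, he, hr]
  push_cast
  linear_combination (-(h : K) ^ n) * hv'

/-! ### Degrees over finite fields -/

open Polynomial in
theorem FiniteField.exists_irreducible_natDegree_eq (k : Type*) [Field k] [Finite k] (n : ℕ)
    (hn : n ≠ 0) : ∃ π : k[X], Irreducible π ∧ π.natDegree = n := by
  obtain ⟨p, _⟩ := CharP.exists k
  have : Fact p.Prime := ⟨CharP.char_is_prime k p⟩
  have : NeZero n := ⟨hn⟩
  obtain ⟨α, hα⟩ := Field.exists_primitive_element k (FiniteField.Extension k p n)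
  have hint : IsIntegral k α := IsIntegral.of_finite k α
  refine ⟨minpoly k α, minpoly.irreducible hint, ?_⟩
  rw [← IntermediateField.adjoin.finrank hint, hα, IntermediateField.finrank_top',
    FiniteField.finrank_extension]

open Polynomial IntermediateField in
/-- Over a finite field, the elements whose degree divides the degree of `t` are generated by `t`. -/
theorem FiniteField.mem_adjoin_of_natDegree_minpoly_dvd {k L : Type*} [Field k] [Finite k]
    [Field L] [Algebra k L] [Module.Finite k L] {t u : L}
    (h : (minpoly k u).natDegree ∣ (minpoly k t).natDegree) : u ∈ k⟮t⟯ := by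
  have hu : IsIntegral k u := IsIntegral.of_finite k u
  have ht : IsIntegral k t := IsIntegral.of_finite k t
  rw [(minpoly.irreducible hu).natDegree_dvd_iff_dvd_X_pow_card_pow_sub_X,
    ← IntermediateField.adjoin.finrank ht] at h
  have : Finite k⟮t⟯ := Module.finite_of_finite k
  obtain ⟨p, _⟩ := CharP.exists k⟮t⟯
  have : Fact p.Prime := ⟨CharP.char_is_prime k⟮t⟯ p⟩
  let := ZMod.algebra k⟮t⟯ p
  -- The divisibility makes `u` a root of `X ^ |k(t)| - X`, which already splits in `k(t)`.
  have hs := FiniteField.splits_X_pow_nat_card_sub_X p (K := k⟮t⟯)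
  have hcard : Nat.card k⟮t⟯ = Nat.card k ^ Module.finrank k k⟮t⟯ := Module.natCard_eq_pow_finrank
  have h1 : aeval u (X ^ Nat.card k⟮t⟯ - X : k[X]) = 0 := by
    rw [hcard]
    exact (minpoly.dvd_iff ..).mp h
  rw [Polynomial.map_sub, Polynomial.map_pow, Polynomial.map_X] at hs
  have := hs.mem_range_of_isRoot (FiniteField.X_pow_card_sub_X_ne_zero _ Finite.one_lt_card)
    (i := algebraMap k⟮t⟯ L) (x := u) (by simpa [IsRoot] using h1)
  obtain ⟨y, rfl⟩ := this
  exact y.2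

open Polynomial IntermediateField in
-- Here `e = [k(u, t) : k(u)]`, bounded by the degree of the nonzero specialisation of `p` that
-- kills `t`; the tower law gives the divisibility.
theorem natDegree_minpoly_dvd_mul_of_aeval_map_eq_zero {k L : Type*} [Field k] [Field L]
    [Algebra k L] [Module.Finite k L] {t u : L} (p : k[X][X])
    (hp : aeval u p.leadingCoeff ≠ 0)
    (h : (p.map (aeval u : k[X] →ₐ[k] L).toRingHom).eval t = 0) :
    ∃ e : ℕ, e ≤ p.natDegree ∧ e ≠ 0 ∧
      (minpoly k t).natDegree ∣ (minpoly k u).natDegree * e := by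
  have hu : IsIntegral k u := IsIntegral.of_finite k u
  have ht : IsIntegral k⟮u⟯ t := IsIntegral.of_finite k⟮u⟯ t
  refine ⟨Module.finrank k⟮u⟯ k⟮u⟯⟮t⟯, ?_, Module.finrank_pos.ne', ?_⟩
  · rw [IntermediateField.adjoin.finrank ht]
    let q : k⟮u⟯[X] := p.map (aeval (AdjoinSimple.gen k u) : k[X] →ₐ[k] k⟮u⟯).toRingHom
    have hq : q.map (algebraMap k⟮u⟯ L) = p.map (aeval u : k[X] →ₐ[k] L).toRingHom := by
      rw [Polynomial.map_map]
      congr 1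
      ext
      · simp [← IsScalarTower.algebraMap_apply]
      · simp
    have hq0 : q ≠ 0 := by
      intro hq0
      rw [hq0, Polynomial.map_zero] at hq
      have := congrArg (fun r ↦ r.coeff p.natDegree) hq
      simp only [coeff_zero, coeff_map] at this
      exact hp this.symm
    refine (natDegree_le_of_dvd (minpoly.dvd _ _ ?_) hq0).trans natDegree_map_le
    rw [aeval_def, ← Polynomial.eval_map, hq, h]
  · rw [← IntermediateField.adjoin.finrank hu, Module.finrank_mul_finrank]
    have : Module.Finite k k⟮u⟯⟮t⟯ := Module.Finite.trans k⟮u⟯ _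
    have : IsScalarTower k k⟮u⟯⟮t⟯ L := .of_algebraMap_eq' rfl
    have := minpoly.degree_dvd (K := k) (x := AdjoinSimple.gen k⟮u⟯ t)
      (IsIntegral.of_finite k _)
    rwa [← minpoly.algebraMap_eq (algebraMap k⟮u⟯⟮t⟯ L).injective] at this

/-! ### Residue fields in which `u` lies in `k(t)` -/

open Polynomial IntermediateField in
theorem exists_algHom_mem_adjoin_simple_of_infinite {k : Type*} {K : Type u} [Field k] [Infinite k]
    [Field K] [Algebra k K] {t u : K} (hu : Transcendental k u)
    [Algebra.IsAlgebraic (Algebra.adjoin k {u}) K] (C : Subalgebra k K) (hC : C.FG)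
    (htC : t ∈ C) (huC : u ∈ C) :
    ∃ (L : Type u) (_ : Field L) (_ : Algebra k L) (ψ : C →ₐ[k] L),
      Module.Finite k L ∧ ψ ⟨u, huC⟩ ∈ k⟮ψ ⟨t, htC⟩⟯ := by
  obtain ⟨h, h0, H⟩ := exists_forall_irreducible_not_dvd_exists_algHom hu C hC huC
  obtain ⟨c, hc⟩ : ∃ c, c ∉ h.rootSet k := (h.rootSet_finite k).exists_notMem
  obtain ⟨L, _, _, ψ, hL, hψ⟩ := H (X - Polynomial.C c) (irreducible_X_sub_C c) (by
    simpa [mem_rootSet, h0, dvd_iff_isRoot] using hc)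
  refine ⟨L, _, _, ψ, hL, ?_⟩
  have : ψ ⟨u, huC⟩ = algebraMap k L c := by simpa [sub_eq_zero] using hψ
  rw [this]
  exact IntermediateField.algebraMap_mem _ c

open Polynomial IntermediateField in
theorem exists_algHom_mem_adjoin_simple_of_finite {k : Type*} {K : Type u} [Field k] [Finite k]
    [Field K] [Algebra k K] {t u : K} (ht : Transcendental k t) (hu : Transcendental k u)
    [Algebra.IsAlgebraic (Algebra.adjoin k {u}) K] (C : Subalgebra k K) (hC : C.FG)
    (htC : t ∈ C) (huC : u ∈ C) :
    ∃ (L : Type u) (_ : Field L) (_ : Algebra k L) (ψ : C →ₐ[k] L),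
      Module.Finite k L ∧ ψ ⟨u, huC⟩ ∈ k⟮ψ ⟨t, htC⟩⟯ := by
  classical
  obtain ⟨p, hp0, hp⟩ : ∃ p : k[X][X], p ≠ 0 ∧
      (p.map (aeval u : k[X] →ₐ[k] K).toRingHom).eval t = 0 := by
    obtain ⟨p, hp0, hp⟩ := Algebra.IsAlgebraic.isAlgebraic (R := Algebra.adjoin k {u}) t
    let e := algEquivOfTranscendental k u hu
    refine ⟨p.map e.symm.toRingEquiv.toRingHom, ?_, ?_⟩
    · rwa [Ne, Polynomial.map_eq_zero_iff e.symm.injective]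
    · rw [Polynomial.map_map, ← hp, aeval_def, ← Polynomial.eval_map]
      congr 2
      refine RingHom.ext fun x ↦ ?_
      obtain ⟨x, rfl⟩ := e.surjective x
      simp [e]
  set c := p.leadingCoeff
  set d := p.natDegree
  -- Inverting `g(t)` excludes points where `t` has degree at most `d`; inverting `c(u)` keeps the
  -- relation between `t` and `u` nonzero.
  let g : k[X] := ∏ i ∈ Finset.Icc 1 d, (X ^ Nat.card k ^ i - X)
  have hg : g ≠ 0 := Finset.prod_ne_zero_iff.mpr fun i hi ↦
    FiniteField.X_pow_card_pow_sub_X_ne_zero _ (by simp at hi; omega) Finite.one_lt_card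
  have hgt : aeval t g ≠ 0 := fun h ↦ hg (transcendental_iff.mp ht g h)
  have hcu : aeval u c ≠ 0 := fun h ↦
    leadingCoeff_ne_zero.mpr hp0 (transcendental_iff.mp hu c h)
  let C' : Subalgebra k K := C ⊔ Algebra.adjoin k {(aeval t g)⁻¹, (aeval u c)⁻¹}
  have hC' : C'.FG := hC.sup ⟨{(aeval t g)⁻¹, (aeval u c)⁻¹}, by simp⟩
  have hCC' : C ≤ C' := le_sup_left
  have hgC' : (aeval t g)⁻¹ ∈ C' := le_sup_right (a := C) (Algebra.subset_adjoin (by simp))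
  have hcC' : (aeval u c)⁻¹ ∈ C' := le_sup_right (a := C) (Algebra.subset_adjoin (by simp))
  obtain ⟨h, h0, H⟩ := exists_forall_irreducible_not_dvd_exists_algHom hu C' hC' (hCC' huC)
  -- An irreducible polynomial of degree above `deg h` cannot divide `h`.
  obtain ⟨l, hl, hlp⟩ := Nat.exists_infinite_primes (h.natDegree + 1)
  obtain ⟨π, hπ, hπl⟩ := FiniteField.exists_irreducible_natDegree_eq k l hlp.ne_zero
  obtain ⟨L, _, _, ψ, hL, hψ⟩ := H π hπ fun hdvd ↦ by
    have := natDegree_le_of_dvd hdvd h0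
    omega
  refine ⟨L, _, _, ψ.comp (Subalgebra.inclusion hCC'), hL, ?_⟩
  set t' : C' := ⟨t, hCC' htC⟩
  set u' : C' := ⟨u, hCC' huC⟩
  change ψ u' ∈ k⟮ψ t'⟯
  have hu' : (minpoly k (ψ u')).natDegree = l := by
    rw [← hπl]
    exact natDegree_eq_of_degree_eq (degree_eq_degree_of_associated
      ((minpoly.irreducible (IsIntegral.of_finite k _)).associated_of_dvd hπ (minpoly.dvd _ _ hψ)))
  have hval {a : C'} {b : K} (hab : (a : K) * b = 1) (hb : b ∈ C') : ψ a ≠ 0 := by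
    refine left_ne_zero_of_mul_eq_one (b := ψ ⟨b, hb⟩) ?_
    rw [← map_mul, ← map_one ψ]
    congr 1
    exact Subtype.ext hab
  have hgL : aeval (ψ t') g ≠ 0 := by
    rw [aeval_algHom_apply]
    refine hval ?_ hgC'
    change C'.val _ * _ = 1
    rw [← aeval_algHom_apply]
    exact mul_inv_cancel₀ hgt
  have hcL : aeval (ψ u') c ≠ 0 := by
    rw [aeval_algHom_apply]
    refine hval ?_ hcC'
    change C'.val _ * _ = 1
    rw [← aeval_algHom_apply]
    exact mul_inv_cancel₀ hcu
  have hpL : (p.map (aeval (ψ u') : k[X] →ₐ[k] L).toRingHom).eval (ψ t') = 0 := by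
    have h1 : (p.map (aeval u' : k[X] →ₐ[k] C').toRingHom).eval t' = 0 := by
      apply Subtype.val_injective
      change C'.val.toRingHom _ = C'.val.toRingHom 0
      rw [← Polynomial.eval_map_apply, Polynomial.map_map, map_zero, ← hp]
      congr 2
      ext <;> simp [u']
    have h2 := congrArg ψ.toRingHom h1
    rw [← Polynomial.eval_map_apply, Polynomial.map_map, map_zero] at h2
    rw [← h2]
    congr 2
    ext <;> simp
  obtain ⟨e, hed, he0, he⟩ := natDegree_minpoly_dvd_mul_of_aeval_map_eq_zero p hcL hpL
  rw [hu'] at he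
  apply FiniteField.mem_adjoin_of_natDegree_minpoly_dvd
  rw [hu']
  by_contra hdvd
  -- If `l ∤ deg t`, then `deg t ∣ e ≤ d`, so `g` vanishes at the image of `t`.
  have hme := Nat.Coprime.dvd_of_dvd_mul_left (hlp.coprime_iff_not_dvd.mpr hdvd).symm he
  have hint : IsIntegral k (ψ t') := IsIntegral.of_finite k _
  apply hgL
  rw [← minpoly.dvd_iff]
  refine ((minpoly.irreducible hint).natDegree_dvd_iff_dvd_X_pow_card_pow_sub_X.mp
    dvd_rfl).trans (Finset.dvd_prod_of_mem _ (Finset.mem_Icc.mpr ⟨?_, ?_⟩))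
  · exact minpoly.natDegree_pos hint
  · exact (Nat.le_of_dvd (Nat.pos_of_ne_zero he0) hme).trans hed

/-! ### Reduction to a curve over a perfect field -/

open Polynomial IntermediateField in
-- Inverting all nonzero polynomials in `b` keeps `b` transcendental modulo any maximal ideal; the
-- quotient is of finite type over `k(b)`, hence finite by Zariski's lemma.
theorem exists_algHom_field_finite_adjoin_simple {k : Type*} {B : Type u} [Field k] [CommRing B]
    [Algebra k B]
    [Algebra.FiniteType k B] {b : B} (hb : Transcendental k b) :
    ∃ (K : Type u) (_ : Field K) (_ : Algebra k K) (φ : B →ₐ[k] K),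
      Transcendental k (φ b) ∧ Module.Finite k⟮φ b⟯ K := by
  let M : Submonoid B := (nonZeroDivisors k[X]).map (aeval b : k[X] →ₐ[k] B)
  have hM : (0 : B) ∉ M := by
    rintro ⟨p, hp, hp0⟩
    exact nonZeroDivisors.ne_zero hp (transcendental_iff.mp hb p hp0)
  have : Nontrivial (Localization M) :=
    not_subsingleton_iff_nontrivial.mp fun h ↦ hM (IsLocalization.subsingleton_iff (M := M).mp h)
  obtain ⟨N, hN⟩ := Ideal.exists_maximal (Localization M)
  let : Field (Localization M ⧸ N) := Ideal.Quotient.field N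
  let φ : B →ₐ[k] Localization M ⧸ N :=
    (Ideal.Quotient.mkₐ k N).comp (Algebra.algHom k B (Localization M))
  have hφ (p : k[X]) (hp : p ≠ 0) : φ (aeval b p) ≠ 0 := by
    have : IsUnit (algebraMap B (Localization M) (aeval b p)) :=
      IsLocalization.map_units _ (⟨_, p, mem_nonZeroDivisors_of_ne_zero hp, rfl⟩ : M)
    exact (this.map (Ideal.Quotient.mk N)).ne_zero
  refine ⟨Localization M ⧸ N, inferInstance, inferInstance, φ, ?_, ?_⟩
  · refine transcendental_iff.mpr fun p hp ↦ ?_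
    by_contra hp0
    exact hφ p hp0 (by rwa [aeval_algHom_apply] at hp)
  obtain ⟨s, hs⟩ := Algebra.FiniteType.out (R := k) (A := B)
  have hB (x : B) : φ x ∈ Algebra.adjoin k⟮φ b⟯ (φ '' s) := by
    have h1 : (⊤ : Subalgebra k B) ≤
        ((Algebra.adjoin k⟮φ b⟯ (φ '' s)).restrictScalars k).comap φ := by
      rw [← hs]
      exact Algebra.adjoin_le fun y hy ↦ Algebra.subset_adjoin ⟨y, hy, rfl⟩
    exact h1 trivial
  have : Algebra.FiniteType k⟮φ b⟯ (Localization M ⧸ N) := by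
    classical
    refine ⟨s.image φ, ?_⟩
    rw [Finset.coe_image, eq_top_iff]
    rintro x -
    obtain ⟨x, rfl⟩ := Ideal.Quotient.mk_surjective x
    obtain ⟨x, ⟨_, p, hp, rfl⟩, rfl⟩ := IsLocalization.exists_mk'_eq M x
    have hp0 := hφ p (nonZeroDivisors.ne_zero hp)
    set m : M := ⟨_, p, hp, rfl⟩
    have h1 : Ideal.Quotient.mk N (IsLocalization.mk' (Localization M) x m) =
        (aeval (AdjoinSimple.gen k (φ b)) p)⁻¹ • φ x := by
      rw [Algebra.smul_def, map_inv₀, ← aeval_algebraMap_apply, AdjoinSimple.algebraMap_gen,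
        aeval_algHom_apply, inv_mul_eq_div, eq_div_iff hp0]
      change Ideal.Quotient.mk N _ * Ideal.Quotient.mk N (algebraMap B _ _) =
        Ideal.Quotient.mk N (algebraMap B _ _)
      rw [← map_mul]
      congr 1
      exact IsLocalization.mk'_spec (Localization M) x m
    rw [h1]
    exact Subalgebra.smul_mem _ (hB x) _
  exact finite_of_finite_type_of_isJacobsonRing _ _

open Polynomial IntermediateField in
theorem exists_transcendental_forall_pow_mem_adjoin_pair {k K : Type*} [Field k] [Field K]
    [Algebra k K] (q : ℕ) [ExpChar k q] {t : K} (ht : Transcendental k t) [Module.Finite k⟮t⟯ K] :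
    ∃ u : K, Transcendental k u ∧ ∀ x : K, ∃ n : ℕ, x ^ q ^ n ∈ k⟮t, u⟯ := by
  obtain ⟨α, hα⟩ := Field.exists_primitive_element k⟮t⟯ (separableClosure k⟮t⟯ K)
  have hE : separableClosure k⟮t⟯ K = k⟮t⟯⟮(α : K)⟯ := by
    have := congrArg IntermediateField.lift hα
    rw [IntermediateField.lift_top, IntermediateField.lift_adjoin_simple] at this
    exact this.symm
  have hpow (x : K) : ∃ n : ℕ, x ^ q ^ n ∈ k⟮t, (α : K)⟯ := by
    have : ExpChar (separableClosure k⟮t⟯ K) q :=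
      expChar_of_injective_algebraMap (algebraMap k _).injective q
    obtain ⟨n, y, hy⟩ := IsPurelyInseparable.pow_mem (separableClosure k⟮t⟯ K) q x
    refine ⟨n, ?_⟩
    rw [← adjoin_simple_adjoin_simple, ← hE, ← hy]
    exact y.2
  by_cases hαt : Transcendental k (α : K)
  · exact ⟨α, hαt, hpow⟩
  -- When `α` is algebraic over `k`, translating by `t` makes it transcendental without changing the
  -- field generated with `t`.
  · refine ⟨t + α, fun h ↦ ht ?_, fun x ↦ ?_⟩
    · simpa using h.sub (not_not.mp hαt)
    · obtain ⟨n, hn⟩ := hpow x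
      refine ⟨n, (adjoin_le_iff.mpr ?_ : k⟮t, (α : K)⟯ ≤ k⟮t, t + α⟯) hn⟩
      have h1 : t ∈ k⟮t, t + α⟯ := subset_adjoin _ _ (by simp)
      have h2 : t + α ∈ k⟮t, t + α⟯ := subset_adjoin _ _ (by simp)
      rintro y (rfl | rfl)
      · exact h1
      · simpa using sub_mem h2 h1

open Polynomial IntermediateField in
theorem isAlgebraic_adjoin_singleton_of_transcendental {k K : Type*} [Field k] [Field K]
    [Algebra k K] {t u : K} (hu : Transcendental k u) [Algebra.IsAlgebraic k⟮t⟯ K] :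
    Algebra.IsAlgebraic (Algebra.adjoin k {u}) K := by
  have : Algebra.IsAlgebraic (Algebra.adjoin k {t}) K := IntermediateField.isAlgebraic_adjoin_iff_top.mp ‹_›
  have h1 : Algebra.trdeg k K ≤ 1 := by
    simpa using Algebra.IsAlgebraic.trdeg_le_cardinalMk (R := k) (A := K) {t}
  have h2 : AlgebraicIndependent k (fun _ : PUnit ↦ u) := algebraicIndependent_unique_type_iff.mpr hu
  have h3 := h2.isTranscendenceBasis_of_trdeg_le (h1.trans_lt Cardinal.one_lt_aleph0)
    (by simpa using h1)
  have h4 : Set.range (fun _ : PUnit ↦ u) = {u} := Set.range_const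
  have h5 := h3.isAlgebraic
  rw [h4] at h5
  exact h5

theorem IntermediateField.mem_of_pow_expChar_pow_mem {k L : Type*} [Field k] [Field L] [Algebra k L]
    [PerfectField k] [Algebra.IsAlgebraic k L] (q : ℕ) [ExpChar k q] (M : IntermediateField k L)
    {x : L} {n : ℕ} (hx : x ^ q ^ n ∈ M) : x ∈ M := by
  have : PerfectField M := Algebra.IsAlgebraic.perfectField k
  have : ExpChar M q := expChar_of_injective_algebraMap (algebraMap k _).injective q
  have : ExpChar L q := expChar_of_injective_algebraMap (algebraMap k _).injective q
  have : PerfectRing M q := PerfectField.toPerfectRing q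
  obtain ⟨y, hy⟩ := (bijective_iterateFrobenius M q n).surjective ⟨_, hx⟩
  have : (y : L) = x := by
    apply iterateFrobenius_inj L q n
    simpa [iterateFrobenius_def] using congrArg Subtype.val hy
  exact this ▸ y.2

open Polynomial IntermediateField in
/-- A finitely generated algebra over a perfect field, containing a transcendental element `b`, has
a residue field at a closed point that is generated by the image of `b`. -/
theorem exists_isMaximal_forall_sub_aeval_mem {k : Type*} {B : Type u} [Field k] [PerfectField k]
    [CommRing B]
    [Algebra k B] [Algebra.FiniteType k B] {b : B} (hb : Transcendental k b) :
    ∃ P : Ideal B, P.IsMaximal ∧ ∀ x : B, ∃ p : k[X], x - aeval b p ∈ P := by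
  classical
  obtain ⟨K, _, _, φ, ht, _⟩ := exists_algHom_field_finite_adjoin_simple hb
  set t := φ b
  obtain ⟨q, _⟩ := ExpChar.exists k
  obtain ⟨u, hu, hpow⟩ := exists_transcendental_forall_pow_mem_adjoin_pair q ht
  have := isAlgebraic_adjoin_singleton_of_transcendental (t := t) hu
  obtain ⟨s, hs⟩ := Algebra.FiniteType.out (R := k) (A := B)
  choose n hn using hpow
  choose r hr d hd hrd using fun x ↦ IntermediateField.mem_adjoin_iff_div.mp (hn x)
  -- The inverted denominators let the formulas `φ x ^ q ^ n = r / d` specialise.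
  let S : Finset K := ({t, u} : Finset K) ∪ s.image φ ∪ s.image (fun x ↦ (d (φ x))⁻¹)
  let C := Algebra.adjoin k (S : Set K)
  have htC : t ∈ C := Algebra.subset_adjoin (by simp [S])
  have huC : u ∈ C := Algebra.subset_adjoin (by simp [S])
  have hφC (x) (hx : x ∈ s) : φ x ∈ C := Algebra.subset_adjoin (by
    simp only [S, Finset.coe_union, Finset.coe_image]
    exact .inl (.inr ⟨x, hx, rfl⟩))
  have hdC (x) (hx : x ∈ s) : (d (φ x))⁻¹ ∈ C := Algebra.subset_adjoin (by
    simp only [S, Finset.coe_union, Finset.coe_image]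
    exact .inr ⟨x, hx, rfl⟩)
  have hBC (x : B) : φ x ∈ C := by
    have h1 : (⊤ : Subalgebra k B) ≤ C.comap φ := hs ▸ Algebra.adjoin_le hφC
    exact h1 trivial
  obtain ⟨L, _, _, ψ, hL, hψ⟩ : ∃ (L : Type u) (_ : Field L) (_ : Algebra k L) (ψ : C →ₐ[k] L),
      Module.Finite k L ∧ ψ ⟨u, huC⟩ ∈ k⟮ψ ⟨t, htC⟩⟯ := by
    have hC : C.FG := ⟨S, rfl⟩
    cases finite_or_infinite k
    · exact exists_algHom_mem_adjoin_simple_of_finite ht hu C hC htC huC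
    · exact exists_algHom_mem_adjoin_simple_of_infinite hu C hC htC huC
  set M := k⟮ψ ⟨t, htC⟩⟯
  have htM : ψ ⟨t, htC⟩ ∈ M := mem_adjoin_simple_self k _
  have hadj (a : K) (ha : a ∈ Algebra.adjoin k {t, u}) : ∃ h : a ∈ C, ψ ⟨a, h⟩ ∈ M := by
    have h1 : Algebra.adjoin k {t, u} ≤ (M.toSubalgebra.comap ψ).map C.val := by
      refine Algebra.adjoin_le ?_
      rintro y (rfl | rfl)
      · exact ⟨⟨_, htC⟩, htM, rfl⟩
      · exact ⟨⟨_, huC⟩, hψ, rfl⟩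
    obtain ⟨a, haM, rfl⟩ := h1 ha
    exact ⟨a.2, haM⟩
  let χ : B →ₐ[k] L := ψ.comp (φ.codRestrict C hBC)
  have hχ (x : B) : χ x ∈ M := by
    have h1 : (⊤ : Subalgebra k B) ≤ M.toSubalgebra.comap χ := by
      rw [← hs]
      refine Algebra.adjoin_le fun x hx ↦ ?_
      refine M.mem_of_pow_expChar_pow_mem q (n := n (φ x)) ?_
      obtain ⟨hrC, hrM⟩ := hadj _ (hr (φ x))
      obtain ⟨hdC', hdM⟩ := hadj _ (hd (φ x))
      have h2 : ψ ⟨_, hdC x hx⟩ = (ψ ⟨_, hdC'⟩)⁻¹ := by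
        -- The denominators are not known to be nonzero; at zero both sides are `0` by the
        -- convention `0⁻¹ = 0`.
        by_cases hd0 : d (φ x) = 0
        · have e1 : (⟨_, hdC x hx⟩ : C) = 0 := Subtype.ext (by simp [hd0])
          have e2 : (⟨_, hdC'⟩ : C) = 0 := Subtype.ext hd0
          rw [e1, e2, map_zero, inv_zero]
        · refine eq_inv_of_mul_eq_one_left ?_
          rw [← map_mul, ← map_one ψ]
          congr 1
          exact Subtype.ext (inv_mul_cancel₀ hd0)
      have h3 : χ x ^ q ^ n (φ x) = ψ ⟨_, hrC⟩ * ψ ⟨_, hdC x hx⟩ := by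
        rw [← map_mul, AlgHom.comp_apply, ← map_pow]
        congr 1
        exact Subtype.ext (by simpa [div_eq_mul_inv] using hrd (φ x))
      change χ x ^ q ^ n (φ x) ∈ M
      rw [h3, h2]
      exact mul_mem hrM (inv_mem hdM)
    exact h1 trivial
  have hgen (y : M) : ∃ p : k[X], χ (aeval b p) = y := by
    have h1 : (y : L) ∈ k⟮ψ ⟨t, htC⟩⟯.toSubalgebra := y.2
    have h2 := adjoin_simple_toSubalgebra_of_isAlgebraic
      (IsIntegral.of_finite k (ψ ⟨t, htC⟩)).isAlgebraic
    rw [h2, Algebra.adjoin_singleton_eq_range_aeval] at h1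
    obtain ⟨p, hp⟩ := h1
    refine ⟨p, ?_⟩
    rw [← hp, ← aeval_algHom_apply]
    rfl
  let χ' : B →ₐ[k] M.toSubalgebra := χ.codRestrict M.toSubalgebra hχ
  refine ⟨RingHom.ker (χ' : B →+* M), RingHom.ker_isMaximal_of_surjective _ fun y ↦ ?_, fun x ↦ ?_⟩
  · obtain ⟨p, hp⟩ := hgen y
    exact ⟨_, Subtype.ext hp⟩
  · obtain ⟨p, hp⟩ := hgen (χ' x)
    refine ⟨p, RingHom.mem_ker.mpr (Subtype.ext ?_)⟩
    change χ (x - aeval b p) = 0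
    rw [map_sub, hp]
    exact sub_self _

/-! ### The dichotomy over a perfect field -/

/-- Some closed point of `Spec B` has a residue field onto which `A` surjects. -/
def HasResiduallySurjectivePoint {A B : Type*} [CommRing A] [CommRing B] (φ : A →+* B) : Prop :=
  ∃ P : Ideal B, P.IsMaximal ∧ Function.Surjective ((Ideal.Quotient.mk P).comp φ)

/-- The image of `Spec B → Spec A` is contained in a finite set of closed points. -/
def HasFiniteClosedImage {A B : Type*} [CommRing A] [CommRing B] (φ : A →+* B) : Prop :=
  ∃ Z : Set (PrimeSpectrum A), Z.Finite ∧ (∀ z ∈ Z, IsClosed {z}) ∧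
    Set.range (PrimeSpectrum.comap φ) ⊆ Z

/-- The range of `φ` is integral and finitely generated, hence Artinian: it has finitely many
primes, all maximal. -/
theorem hasFiniteClosedImage_of_forall_isAlgebraic {k A B : Type*} [Field k] [CommRing A]
    [CommRing B] [Algebra k A] [Algebra k B] [Algebra.FiniteType k A] (φ : A →ₐ[k] B)
    (h : ∀ a, IsAlgebraic k (φ a)) : HasFiniteClosedImage (φ : A →+* B) := by
  have : Algebra.FiniteType k φ.range := .of_surjective φ.rangeRestrict φ.rangeRestrict_surjective
  have : Algebra.IsIntegral k φ.range := by
    refine ⟨fun x ↦ ?_⟩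
    obtain ⟨a, ha⟩ := x.2
    rw [← isIntegral_algHom_iff φ.range.val Subtype.val_injective]
    have h1 : φ.range.val x = φ a := ha.symm
    exact h1 ▸ (h a).isIntegral
  have : Module.Finite k φ.range := Algebra.IsIntegral.finite
  have : IsArtinianRing φ.range := isArtinian_of_tower k inferInstance
  refine ⟨Set.range (PrimeSpectrum.comap (φ.rangeRestrict : A →+* φ.range)), Set.finite_range _,
    ?_, ?_⟩
  · rintro _ ⟨P, rfl⟩
    rw [PrimeSpectrum.isClosed_singleton_iff_isMaximal]
    exact Ideal.comap_isMaximal_of_surjective _ φ.rangeRestrict_surjective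
  · rintro _ ⟨P, rfl⟩
    exact ⟨PrimeSpectrum.comap (φ.range.val : φ.range →+* B) P, rfl⟩

theorem hasResiduallySurjectivePoint_or_hasFiniteClosedImage_of_field {k A : Type*} {B : Type u}
    [Field k] [PerfectField k] [CommRing A] [CommRing B] (α : k →+* A) (φ : A →+* B)
    (hα : α.FiniteType) (hφ : (φ.comp α).FiniteType) :
    HasResiduallySurjectivePoint φ ∨ HasFiniteClosedImage φ := by
  let := α.toAlgebra
  let := (φ.comp α).toAlgebra
  have : Algebra.FiniteType k A := hα
  have : Algebra.FiniteType k B := hφ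
  let φ' : A →ₐ[k] B := { φ with commutes' := fun _ ↦ rfl }
  by_cases h : ∀ a, IsAlgebraic k (φ' a)
  · exact .inr (hasFiniteClosedImage_of_forall_isAlgebraic φ' h)
  · obtain ⟨a, ha⟩ := not_forall.mp h
    obtain ⟨P, hP, H⟩ := exists_isMaximal_forall_sub_aeval_mem ha
    refine .inl ⟨P, hP, fun y ↦ ?_⟩
    obtain ⟨x, rfl⟩ := Ideal.Quotient.mk_surjective y
    obtain ⟨p, hp⟩ := H x
    refine ⟨Polynomial.aeval a p, ?_⟩
    rw [Polynomial.aeval_algHom_apply] at hp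
    exact (Ideal.Quotient.eq.mpr hp).symm

/-! ### The dichotomy over the integers -/

open Polynomial in
-- Euclid's argument: with `a = f(0) ≠ 0`, `f(aNy) = a * m` where `m ≡ 1` mod `N`, and all but
-- finitely many `y` give `m ≠ ±1`.
theorem Polynomial.exists_prime_not_dvd_and_dvd_eval {f : ℤ[X]} (hf : 0 < f.natDegree) {N : ℤ}
    (hN : N ≠ 0) : ∃ (p : ℕ) (c : ℤ), p.Prime ∧ ¬ (p : ℤ) ∣ N ∧ (p : ℤ) ∣ f.eval c := by
  set a := f.coeff 0 with ha
  obtain ⟨g, hg⟩ : X ∣ f - C a := by simp [X_dvd_iff, ha]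
  have hfg (x : ℤ) : f.eval x = a + x * g.eval x := by
    have := congrArg (eval x) hg
    simp only [eval_sub, eval_C, eval_mul, eval_X] at this
    linarith
  by_cases ha0 : a = 0
  · obtain ⟨p, hpN, hp⟩ := Nat.exists_infinite_primes (N.natAbs + 1)
    refine ⟨p, p, hp, fun h ↦ ?_, ?_⟩
    · have := Nat.le_of_dvd (Int.natAbs_pos.mpr hN) (Int.natCast_dvd.mp h)
      omega
    · rw [hfg, ha0, zero_add]
      exact dvd_mul_right _ _
  · have hne (b : ℤ) : f - C b ≠ 0 := fun h ↦ by
      rw [sub_eq_zero.mp h, natDegree_C] at hf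
      exact hf.false
    have hinj : Function.Injective fun y : ℤ ↦ a * N * y :=
      mul_right_injective₀ (mul_ne_zero ha0 hN)
    obtain ⟨y, hy⟩ : ∃ y, y ∉ (fun y : ℤ ↦ a * N * y) ⁻¹'
        ((f - C a).rootSet ℤ ∪ (f - C (-a)).rootSet ℤ) :=
      (((rootSet_finite _ _).union (rootSet_finite _ _)).preimage hinj.injOn).exists_notMem
    have hroot (b : ℤ) (h : a * N * y ∉ (f - C b).rootSet ℤ) : f.eval (a * N * y) ≠ b :=
      fun hb ↦ h (mem_rootSet.mpr ⟨hne b, by simp [hb, -eq_intCast]⟩)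
    have hy1 := hroot a fun h ↦ hy (.inl h)
    have hy2 := hroot (-a) fun h ↦ hy (.inr h)
    set m := 1 + N * y * g.eval (a * N * y)
    have hm : f.eval (a * N * y) = a * m := by rw [hfg]; ring
    have hm1 : m.natAbs ≠ 1 := by
      intro h
      rcases Int.natAbs_eq_iff.mp h with h | h
      · exact hy1 (by simp [hm, h])
      · exact hy2 (by simp [hm, h])
    obtain ⟨p, hp, hpm⟩ := Nat.exists_prime_and_dvd hm1
    have hpm' : (p : ℤ) ∣ m := Int.natCast_dvd.mpr hpm
    refine ⟨p, a * N * y, hp, fun h ↦ ?_, hm ▸ hpm'.mul_left a⟩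
    have : (p : ℤ) ∣ 1 := (Int.dvd_add_left ((h.mul_right y).mul_right _)).mp hpm'
    exact hp.one_lt.ne' (by simpa [Int.natCast_dvd] using this)

open TensorProduct in
-- The generic fibre `ℚ ⊗ B` is nonzero by flatness, and its residue fields at maximal ideals are
-- number fields by Zariski's lemma.
theorem exists_ringHom_numberField {B : Type u} [CommRing B] [Algebra.FiniteType ℤ B]
    (hB : Function.Injective (algebraMap ℤ B)) :
    ∃ (K : Type u) (_ : Field K) (_ : Algebra ℚ K) (_ : B →+* K), Module.Finite ℚ K := by
  have : Module.Flat ℤ ℚ := IsLocalization.flat ℚ (nonZeroDivisors ℤ)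
  have : Nontrivial (ℚ ⊗[ℤ] B) :=
    (Algebra.TensorProduct.includeLeft_injective (S := ℤ) (A := ℚ) hB).nontrivial
  obtain ⟨N, hN⟩ := Ideal.exists_maximal (ℚ ⊗[ℤ] B)
  let : Field (ℚ ⊗[ℤ] B ⧸ N) := Ideal.Quotient.field N
  have : Algebra.FiniteType ℚ (ℚ ⊗[ℤ] B ⧸ N) :=
    .of_surjective (Ideal.Quotient.mkₐ ℚ N) (Ideal.Quotient.mkₐ_surjective ℚ N)
  exact ⟨_, inferInstance, inferInstance, (Ideal.Quotient.mk N).comp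
    (Algebra.TensorProduct.includeRight : B →ₐ[ℤ] ℚ ⊗[ℤ] B).toRingHom,
    finite_of_finite_type_of_isJacobsonRing _ _⟩

theorem exists_isIntegral_forall_exists_smul_mem_adjoin (K : Type*) [Field K] [Algebra ℚ K]
    [Module.Finite ℚ K] :
    ∃ α : K, IsIntegral ℤ α ∧ ∀ x : K, ∃ n : ℤ, n ≠ 0 ∧ n • x ∈ Algebra.adjoin ℤ {α} := by
  obtain ⟨β, hβ⟩ := Field.exists_primitive_element ℚ K
  have hβalg : IsAlgebraic ℤ β :=
    (IsFractionRing.isAlgebraic_iff ℤ ℚ K).mpr (IsIntegral.of_finite ℚ β).isAlgebraic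
  obtain ⟨m, hm0, hm⟩ := hβalg.exists_integral_multiple
  refine ⟨m • β, hm, fun x ↦ ?_⟩
  have hx : x ∈ Algebra.adjoin ℚ {β} := by
    rw [← IntermediateField.adjoin_simple_toSubalgebra_of_isAlgebraic
      (IsIntegral.of_finite ℚ β).isAlgebraic, hβ]
    trivial
  induction hx using Algebra.adjoin_induction with
  | mem x hx =>
    rw [Set.mem_singleton_iff] at hx
    exact ⟨m, hm0, hx ▸ Algebra.self_mem_adjoin_singleton _ _⟩
  | algebraMap r =>
    refine ⟨r.den, by exact_mod_cast r.den_ne_zero, ?_⟩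
    have : (r.den : ℤ) • algebraMap ℚ K r = algebraMap ℤ K r.num := by
      rw [IsScalarTower.algebraMap_apply ℤ ℚ K, ← map_zsmul]
      congr 1
      simp [Rat.den_mul_eq_num]
    rw [this]
    exact Subalgebra.algebraMap_mem _ _
  | add x y _ _ hx hy =>
    obtain ⟨a, ha0, ha⟩ := hx
    obtain ⟨b, hb0, hb⟩ := hy
    refine ⟨a * b, mul_ne_zero ha0 hb0, ?_⟩
    have : (a * b) • (x + y) = b • a • x + a • b • y := by
      rw [smul_add, mul_smul, mul_smul, smul_comm a b x]
    rw [this]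
    exact add_mem (Subalgebra.smul_mem _ ha _) (Subalgebra.smul_mem _ hb _)
  | mul x y _ _ hx hy =>
    obtain ⟨a, ha0, ha⟩ := hx
    obtain ⟨b, hb0, hb⟩ := hy
    refine ⟨a * b, mul_ne_zero ha0 hb0, ?_⟩
    rw [← smul_mul_smul_comm]
    exact mul_mem ha hb

theorem exists_prime_nonempty_ringHom_zmod {B : Type*} [CommRing B] [Algebra.FiniteType ℤ B]
    (hB : Function.Injective (algebraMap ℤ B)) :
    ∃ p : ℕ, p.Prime ∧ Nonempty (B →+* ZMod p) := by
  classical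
  obtain ⟨K, _, _, φ, _⟩ := exists_ringHom_numberField hB
  obtain ⟨α, hα, H⟩ := exists_isIntegral_forall_exists_smul_mem_adjoin K
  choose n hn0 hn using H
  have : CharZero K := algebraRat.charZero K
  obtain ⟨s, hs⟩ := Algebra.FiniteType.out (R := ℤ) (A := B)
  set N := ∏ x ∈ s, n (φ x)
  have hN0 : N ≠ 0 := Finset.prod_ne_zero_iff.mpr fun x _ ↦ hn0 _
  obtain ⟨p, c, hp, hpN, hpc⟩ :=
    Polynomial.exists_prime_not_dvd_and_dvd_eval (minpoly.natDegree_pos hα) hN0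
  have : Fact p.Prime := ⟨hp⟩
  refine ⟨p, hp, ?_⟩
  set O := Algebra.adjoin ℤ {α}
  have : FaithfulSMul O K := (faithfulSMul_iff_algebraMap_injective O K).mpr Subtype.val_injective
  have : IsFractionRing O K := IsFractionRing.of_field O K fun z ↦ by
    refine ⟨⟨_, hn z⟩, algebraMap ℤ O (n z), ?_⟩
    have : (n z : K) ≠ 0 := Int.cast_ne_zero.mpr (hn0 z)
    change z = (n z • z) / algebraMap O K (algebraMap ℤ O (n z))
    rw [← IsScalarTower.algebraMap_apply, eq_intCast, zsmul_eq_mul, mul_div_cancel_left₀ _ this]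
  -- The integer `c` is a root mod `p` of the minimal polynomial of `α`. As `p ∤ N`, this map
  -- extends to `ℤ[α][1/N]`, which contains the image of `B`.
  let θ : O →+* ZMod p :=
    (AdjoinRoot.lift (Int.castRingHom (ZMod p)) (c : ZMod p) (by
      have := (ZMod.intCast_zmod_eq_zero_iff_dvd _ p).mpr hpc
      rw [← eq_intCast (Int.castRingHom (ZMod p)) c, Polynomial.eval₂_at_apply]
      exact_mod_cast this)).comp (minpoly.equivAdjoin hα).symm.toRingEquiv.toRingHom
  let S : Submonoid O := Submonoid.powers (N : O)
  have hNO : (N : O) ≠ 0 := fun h ↦ hN0 (by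
    have := congrArg Subtype.val h
    exact_mod_cast this)
  have hS : S ≤ nonZeroDivisors O := powers_le_nonZeroDivisors_of_noZeroDivisors hNO
  let C := Localization.subalgebra.ofField K S hS
  have hθ (y : S) : IsUnit (θ y) := by
    obtain ⟨_, m, rfl⟩ := y
    simp only [map_pow, map_intCast]
    refine (Ne.isUnit fun h ↦ hpN ?_).pow m
    exact (ZMod.intCast_zmod_eq_zero_iff_dvd N p).mp h
  let θ' : C →+* ZMod p := IsLocalization.lift hθ
  have hC (x : B) : φ x ∈ C := by
    let φ' : B →ₐ[ℤ] K := φ.toIntAlgHom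
    have h1 : (⊤ : Subalgebra ℤ B) ≤ (C.restrictScalars ℤ).comap φ' := by
      rw [← hs]
      refine Algebra.adjoin_le fun x hx ↦ ⟨⟨N • φ x, ?_⟩, N, Submonoid.mem_powers _, ?_⟩
      · have h2 : N • φ x = (∏ y ∈ s.erase x, n (φ y)) • n (φ x) • φ x := by
          rw [smul_smul, Finset.prod_erase_mul _ _ hx]
        rw [h2]
        exact Subalgebra.smul_mem _ (hn _) _
      · have : (N : K) ≠ 0 := Int.cast_ne_zero.mpr hN0
        change φ x = (N • φ x) * (algebraMap O K (N : O))⁻¹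
        rw [map_intCast, zsmul_eq_mul]
        field_simp
    exact h1 trivial
  exact ⟨θ'.comp (φ.codRestrict C.toSubring hC)⟩

theorem hasResiduallySurjectivePoint_of_ringHom_zmod {A B : Type*} [CommRing A] [CommRing B]
    (φ : A →+* B) {p : ℕ} (hp : p.Prime) (θ : B →+* ZMod p) : HasResiduallySurjectivePoint φ := by
  have : Fact p.Prime := ⟨hp⟩
  refine ⟨RingHom.ker θ, RingHom.ker_isMaximal_of_surjective _ (ZMod.ringHom_surjective θ),
    fun y ↦ ?_⟩
  obtain ⟨x, rfl⟩ := Ideal.Quotient.mk_surjective y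
  obtain ⟨n, hn⟩ := ZMod.intCast_surjective (θ x)
  refine ⟨n, Ideal.Quotient.eq.mpr ?_⟩
  rw [RingHom.mem_ker, map_sub, map_intCast, map_intCast, hn, sub_self]

theorem hasResiduallySurjectivePoint_or_exists_finite_of_prime {A B : Type*} [CommRing A]
    [CommRing B] [Algebra.FiniteType ℤ A] [Algebra.FiniteType ℤ B] (φ : A →+* B) {p : ℕ}
    (hp : p.Prime) :
    HasResiduallySurjectivePoint φ ∨ ∃ Z : Set (PrimeSpectrum A), Z.Finite ∧
      (∀ z ∈ Z, IsClosed {z}) ∧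
        ∀ P : PrimeSpectrum B, (p : B) ∈ P.asIdeal → PrimeSpectrum.comap φ P ∈ Z := by
  have : Fact p.Prime := ⟨hp⟩
  let I : Ideal A := Ideal.span {(p : A)}
  let J : Ideal B := Ideal.span {(p : B)}
  let φ' : A ⧸ I →+* B ⧸ J := Ideal.quotientMap J φ (by
    simp [I, J, Ideal.span_le])
  let α : ZMod p →+* A ⧸ I :=
    (Ideal.quotientMap I (algebraMap ℤ A) (by simp [I, Ideal.span_le])).comp
      (Int.quotientSpanNatEquivZMod p).symm.toRingHom
  have hA : (algebraMap ℤ (A ⧸ I)).FiniteType := by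
    rw [IsScalarTower.algebraMap_eq ℤ A]
    exact (RingHom.FiniteType.of_surjective _ Ideal.Quotient.mk_surjective).comp
      (RingHom.finiteType_algebraMap.mpr ‹_›)
  have hB : (algebraMap ℤ (B ⧸ J)).FiniteType := by
    rw [IsScalarTower.algebraMap_eq ℤ B]
    exact (RingHom.FiniteType.of_surjective _ Ideal.Quotient.mk_surjective).comp
      (RingHom.finiteType_algebraMap.mpr ‹_›)
  have hα : α.FiniteType := by
    refine RingHom.FiniteType.of_comp_finiteType (f := Int.castRingHom (ZMod p)) ?_
    convert hA
    exact RingHom.ext_int _ _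
  have hφα : (φ'.comp α).FiniteType := by
    refine RingHom.FiniteType.of_comp_finiteType (f := Int.castRingHom (ZMod p)) ?_
    convert hB
    exact RingHom.ext_int _ _
  rcases hasResiduallySurjectivePoint_or_hasFiniteClosedImage_of_field α φ' hα hφα with
    ⟨P, hP, h⟩ | ⟨Z, hZ, hZc, hZr⟩
  · left
    refine ⟨P.comap (Ideal.Quotient.mk J),
      Ideal.comap_isMaximal_of_surjective _ Ideal.Quotient.mk_surjective, fun y ↦ ?_⟩
    obtain ⟨x, rfl⟩ := Ideal.Quotient.mk_surjective y
    obtain ⟨a, ha⟩ := h (Ideal.Quotient.mk P (Ideal.Quotient.mk J x))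
    obtain ⟨a, rfl⟩ := Ideal.Quotient.mk_surjective a
    refine ⟨a, Ideal.Quotient.eq.mpr ?_⟩
    rw [Ideal.mem_comap, map_sub]
    exact Ideal.Quotient.eq.mp ha
  · right
    refine ⟨PrimeSpectrum.comap (Ideal.Quotient.mk I) '' Z, hZ.image _, ?_, fun P hP ↦ ?_⟩
    · rintro _ ⟨z, hz, rfl⟩
      have := (PrimeSpectrum.isClosed_singleton_iff_isMaximal z).mp (hZc z hz)
      rw [PrimeSpectrum.isClosed_singleton_iff_isMaximal]
      exact Ideal.comap_isMaximal_of_surjective _ Ideal.Quotient.mk_surjective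
    · obtain ⟨Q, rfl⟩ : P ∈ Set.range (PrimeSpectrum.comap (Ideal.Quotient.mk J)) := by
        rw [range_comap_of_surjective _ _ Ideal.Quotient.mk_surjective]
        simpa [J, Set.subset_def] using hP
      exact ⟨PrimeSpectrum.comap φ' Q, hZr ⟨Q, rfl⟩, rfl⟩

theorem hasResiduallySurjectivePoint_or_hasFiniteClosedImage_of_int {A B : Type*} [CommRing A]
    [CommRing B] [Algebra.FiniteType ℤ A] [Algebra.FiniteType ℤ B] (φ : A →+* B) :
    HasResiduallySurjectivePoint φ ∨ HasFiniteClosedImage φ := by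
  by_cases hB : Function.Injective (algebraMap ℤ B)
  · obtain ⟨p, hp, ⟨θ⟩⟩ := exists_prime_nonempty_ringHom_zmod hB
    exact .inl (hasResiduallySurjectivePoint_of_ringHom_zmod φ hp θ)
  by_cases h : HasResiduallySurjectivePoint φ
  · exact .inl h
  right
  obtain ⟨N, hN, hN0⟩ : ∃ N : ℤ, algebraMap ℤ B N = 0 ∧ N ≠ 0 := by
    rw [injective_iff_map_eq_zero] at hB
    push Not at hB
    exact hB
  choose Z hZ hZc hZr using fun p : {p : ℕ // p.Prime} ↦
    (hasResiduallySurjectivePoint_or_exists_finite_of_prime φ p.2).resolve_left h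
  let T : Set {p : ℕ // p.Prime} := {p | p.1 ∣ N.natAbs}
  have hT : T.Finite := ((Set.finite_Iic N.natAbs).preimage Subtype.val_injective.injOn).subset
    fun p hp ↦ Nat.le_of_dvd (Int.natAbs_pos.mpr hN0) hp
  refine ⟨⋃ p ∈ T, Z p, hT.biUnion fun p _ ↦ hZ p, ?_, ?_⟩
  · simp only [Set.mem_iUnion]
    rintro z ⟨p, _, hz⟩
    exact hZc p z hz
  · rintro _ ⟨P, rfl⟩
    -- Since `N` vanishes in `B`, every prime ideal contains a prime factor of `N`.
    have hNP : ((N.natAbs : ℕ) : B) ∈ P.asIdeal := by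
      rcases Int.natAbs_eq N with h | h <;> rw [h] at hN <;> simp at hN <;> simp [hN]
    rw [← Nat.prod_primeFactorsList (Int.natAbs_ne_zero.mpr hN0), Nat.cast_list_prod] at hNP
    obtain ⟨x, hx, hxP⟩ := (P.2.multiset_prod_mem_iff_exists_mem
      (N.natAbs.primeFactorsList.map (Nat.cast : ℕ → B))).mp (by simpa using hNP)
    obtain ⟨p, hp, rfl⟩ := List.mem_map.mp (Multiset.mem_coe.mp hx)
    have hp' := Nat.prime_of_mem_primeFactorsList hp
    exact Set.mem_biUnion (x := ⟨p, hp'⟩) (Nat.dvd_of_mem_primeFactorsList hp) (hZr ⟨p, hp'⟩ P hxP)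

/-! ### From rings to schemes -/

theorem AlgebraicGeometry.IsAffineOpen.evaluation_surjective {X : Scheme.{u}} {V : X.Opens}
    (hV : IsAffineOpen V) (x : V) (hx : (hV.primeIdealOf x).asIdeal.IsMaximal) :
    Function.Surjective (X.evaluation V x x.2).hom := by
  let := X.presheaf.algebra_section_stalk x
  have := hV.isLocalization_stalk x
  intro z
  obtain ⟨y, hy⟩ := (IsLocalization.AtPrime.equivQuotMaximalIdeal (hV.primeIdealOf x).asIdeal
    (X.presheaf.stalk (x : X))).surjective z
  obtain ⟨b, rfl⟩ := Ideal.Quotient.mk_surjective y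
  exact ⟨b, hy⟩

theorem AlgebraicGeometry.IsAffineOpen.evaluation_eq_zero_of_mem {X : Scheme.{u}} {V : X.Opens}
    (hV : IsAffineOpen V) (x : V) {b : Γ(X, V)} (hb : b ∈ (hV.primeIdealOf x).asIdeal) :
    (X.evaluation V x x.2).hom b = 0 := by
  let := X.presheaf.algebra_section_stalk x
  have := hV.isLocalization_stalk x
  refine (IsLocalRing.residue_eq_zero_iff _).mpr ?_
  exact (IsLocalization.AtPrime.to_map_mem_maximal_iff (X.presheaf.stalk (x : X))
    (hV.primeIdealOf x).asIdeal b).mpr hb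

theorem rel_nonempty_of_hasResiduallySurjectivePoint {X Y : Scheme.{u}} (f : X ⟶ Y) {U : Y.Opens}
    {V : X.Opens} (hV : IsAffineOpen V) (e : V ≤ f ⁻¹ᵁ U)
    (h : HasResiduallySurjectivePoint (f.appLE U V e).hom) : (rel f).Nonempty := by
  obtain ⟨P, hP, hsurj⟩ := h
  obtain ⟨x, hx⟩ : ∃ x : V, hV.primeIdealOf x = ⟨P, hP.isPrime⟩ := by
    let y : Spec Γ(X, V) := ⟨P, hP.isPrime⟩
    have hy : hV.fromSpec y ∈ V := hV.range_fromSpec.subset ⟨y, rfl⟩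
    exact ⟨⟨_, hy⟩, hV.fromSpec.isOpenEmbedding.injective (hV.fromSpec_primeIdealOf _)⟩
  have hxP : (hV.primeIdealOf x).asIdeal = P := congrArg PrimeSpectrum.asIdeal hx
  refine ⟨f x, x, ⟨(f.residueFieldMap x).hom.injective, fun z ↦ ?_⟩, rfl⟩
  obtain ⟨b, rfl⟩ := hV.evaluation_surjective x (hxP ▸ hP) z
  obtain ⟨a, ha⟩ := hsurj (Ideal.Quotient.mk P b)
  have hab : (f.appLE U V e).hom a - b ∈ (hV.primeIdealOf x).asIdeal :=
    hxP ▸ Ideal.Quotient.eq.mp ha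
  have h0 := hV.evaluation_eq_zero_of_mem x hab
  rw [map_sub, sub_eq_zero] at h0
  refine ⟨(Y.evaluation U (f x) (e x.2)).hom a, ?_⟩
  rw [← h0]
  refine (Scheme.evaluation_naturality_apply f (x : X) (e x.2) a).trans ?_
  exact (congrArg (X.residue (x : X)) (X.presheaf.germ_res_apply (homOfLE e) x x.2 (f.app U a))).symm

theorem isOpen_singleton_of_forall_hasFiniteClosedImage {X Y : Scheme.{u}} (f : X ⟶ Y)
    [QuasiCompact f] [IsDominant f] {V : Y.Opens} (hV : IsAffineOpen V)
    (hfin : ∀ (W : X.Opens), IsAffineOpen W → ∀ e : W ≤ f ⁻¹ᵁ V,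
      HasFiniteClosedImage (f.appLE V W e).hom) {y : Y} (hy : y ∈ V) :
    IsOpen ({y} : Set Y) := by
  obtain ⟨T, hT, hTV⟩ := (isCompact_iff_finite_and_eq_biUnion_affineOpens (U := f ⁻¹ᵁ V)).mp
    (QuasiCompact.isCompact_preimage (f := f) V V.2 hV.isCompact)
  choose! Z hZ hZc hZr using fun W : X.affineOpens ↦ hfin W W.2
  have hle {W : X.affineOpens} (hW : W ∈ T) : (W : X.Opens) ≤ f ⁻¹ᵁ V := hTV ▸ le_biSup _ hW
  let Z' : Set (PrimeSpectrum Γ(Y, V)) := ⋃ W ∈ T, Z W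
  have hZ'c : ∀ z ∈ Z', IsClosed {z} := by
    intro z hz
    obtain ⟨W, hW, hz⟩ := Set.mem_iUnion₂.mp hz
    exact hZc W (hle hW) z hz
  have hZ'fin : Z'.Finite := hT.biUnion fun W hW ↦ hZ W (hle hW)
  have hZ'closed : IsClosed Z' := by
    rw [← Set.biUnion_of_singleton Z']
    exact hZ'fin.isClosed_biUnion hZ'c
  have hfZ (x : X) (hx : f x ∈ V) : ∃ z ∈ Z', hV.fromSpec z = f x := by
    have hx' : x ∈ ⨆ W ∈ T, (W : X.Opens) := hTV ▸ hx
    simp only [TopologicalSpace.Opens.mem_iSup] at hx'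
    obtain ⟨W, hW, hxW⟩ := hx'
    refine ⟨hV.primeIdealOf ⟨f x, hx⟩, Set.mem_biUnion hW (hZr W (hle hW) ?_),
      hV.fromSpec_primeIdealOf _⟩
    exact ⟨W.2.primeIdealOf ⟨x, hxW⟩, IsAffineOpen.comap_primeIdealOf_appLE V hV (W : X.Opens) W.2 (hle hW) hxW⟩
  -- The complement of the closed set `Z'` is open and misses the image of `f`, so density makes it
  -- empty; `V` is then finite and T1, hence discrete.
  have huniv (z : PrimeSpectrum Γ(Y, V)) : z ∈ Z' := by
    by_contra hz
    obtain ⟨_, ⟨z₀, hz₀, hzx₀⟩, x, rfl⟩ := (IsDominant.denseRange (f := f)).inter_open_nonempty _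
      (hV.fromSpec.isOpenEmbedding.isOpenMap _ hZ'closed.isOpen_compl) ⟨_, z, hz, rfl⟩
    have hx : f x ∈ V := hzx₀ ▸ hV.range_fromSpec.subset ⟨z₀, rfl⟩
    obtain ⟨z', hz', hzx⟩ := hfZ x hx
    exact hz₀ (hV.fromSpec.isOpenEmbedding.injective (hzx₀.trans hzx.symm) ▸ hz')
  have : Finite (PrimeSpectrum Γ(Y, V)) :=
    Set.finite_univ_iff.mp (hZ'fin.subset fun z _ ↦ huniv z)
  have : T1Space (PrimeSpectrum Γ(Y, V)) := ⟨fun z ↦ hZ'c z (huniv z)⟩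
  have hopen := hV.fromSpec.isOpenEmbedding.isOpenMap {hV.primeIdealOf ⟨y, hy⟩}
    (isOpen_discrete (α := PrimeSpectrum Γ(Y, V)) _)
  have himage : hV.fromSpec '' {hV.primeIdealOf ⟨y, hy⟩} = {y} :=
    Set.image_singleton.trans (congrArg _ (hV.fromSpec_primeIdealOf _))
  exact himage ▸ hopen

theorem isStrictPoonen_of_forall_hasResiduallySurjectivePoint_or_hasFiniteClosedImage
    {R : CommRingCat.{u}} {S : Scheme.{u}} (g : S ⟶ Spec R) (hg : IsOfFiniteType g)
    (hS : HasNoIsolatedPoint S)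
    (h : ∀ (A B : Type u) [CommRing A] [CommRing B] (α : R →+* A) (φ : A →+* B),
      α.FiniteType → (φ.comp α).FiniteType →
        HasResiduallySurjectivePoint φ ∨ HasFiniteClosedImage φ) :
    IsStrictPoonen S := by
  intro U ⟨s, hs⟩ X f hf hdom
  by_contra hrel
  have := hg.locallyOfFiniteType
  have := hf.locallyOfFinitePresentation
  have := hf.quasiCompact
  obtain ⟨V, hV, hsV, -⟩ := exists_isAffineOpen_mem_and_subset
    (X := (U : Scheme.{u})) (x := ⟨s, hs⟩) (U := ⊤) trivial
  let α : R →+* Γ(U, V) :=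
    ((U.ι ≫ g).appLE ⊤ V le_top).hom.comp (Scheme.ΓSpecIso R).inv.hom
  have hR : Function.Surjective (Scheme.ΓSpecIso R).inv.hom :=
    (Scheme.ΓSpecIso R).symm.commRingCatIsoToRingEquiv.surjective
  have hα : α.FiniteType :=
    RingHom.FiniteType.comp
      (LocallyOfFiniteType.finiteType_appLE (f := U.ι ≫ g) (isAffineOpen_top _) hV le_top)
      (RingHom.FiniteType.of_surjective _ hR)
  have hfin (W : X.Opens) (hW : IsAffineOpen W) (e : W ≤ f ⁻¹ᵁ V) :
      HasFiniteClosedImage (f.appLE V W e).hom := by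
    refine (h _ _ α (f.appLE V W e).hom hα ?_).resolve_left fun h ↦
      hrel (rel_nonempty_of_hasResiduallySurjectivePoint f hW e h)
    exact RingHom.FiniteType.comp (LocallyOfFiniteType.finiteType_appLE (f := f) hV hW e) hα
  have hopen := U.ι.isOpenEmbedding.isOpenMap _
    (isOpen_singleton_of_forall_hasFiniteClosedImage f hV hfin hsV)
  exact hS _ ((congrArg IsOpen Set.image_singleton).mp hopen)

theorem mainTheorem12 :
    (∀ (k : Type u) [Field k] [PerfectField k] (S : Scheme.{u})
      (g : S ⟶ Spec (CommRingCat.of k)),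
      IsOfFiniteType g → HasNoIsolatedPoint S → IsStrictPoonen S) ∧
    (∀ (S : Scheme.{u}) (g : S ⟶ Spec (CommRingCat.of (ULift.{u} ℤ))),
      IsOfFiniteType g → HasNoIsolatedPoint S → IsStrictPoonen S) := by
  refine ⟨fun k _ _ S g hg hS ↦ ?_, fun S g hg hS ↦ ?_⟩
  · exact isStrictPoonen_of_forall_hasResiduallySurjectivePoint_or_hasFiniteClosedImage g hg hS
      fun A B _ _ α φ ↦ hasResiduallySurjectivePoint_or_hasFiniteClosedImage_of_field (k := k) α φ
  · refine isStrictPoonen_of_forall_hasResiduallySurjectivePoint_or_hasFiniteClosedImage g hg hS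
      fun A B _ _ α φ hα hφ ↦ ?_
    have hR : (ULift.ringEquiv.symm : ℤ ≃+* ULift.{u} ℤ).toRingHom.FiniteType :=
      RingHom.FiniteType.of_surjective _ (ULift.ringEquiv.symm : ℤ ≃+* ULift.{u} ℤ).surjective
    have : Algebra.FiniteType ℤ A := by
      rw [← RingHom.finiteType_algebraMap, RingHom.ext_int (algebraMap ℤ A)]
      exact hα.comp hR
    have : Algebra.FiniteType ℤ B := by
      rw [← RingHom.finiteType_algebraMap, RingHom.ext_int (algebraMap ℤ B)]
      exact hφ.comp hR
    exact hasResiduallySurjectivePoint_or_hasFiniteClosedImage_of_int φ
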